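/- A unit vector $\psi\in\bigotimes_{i\in I}\mathbb C^{\delta_i}$ ($I$ a finite set of parties) is called $r$-uniform, for an integer $0\le r\le |I|$, if for every $r$-element set $S\subseteq I$ the partial trace of $|\psi\rangle\langle\psi|$ over the parties outside $S$ equals $\bigl(\prod_{i\in S}\delta_i\bigr)^{-1}\mathbb 1_S$. An $((n,K,d))_D$ quantum code ($d\ge 1$) is a $K$-dimensional subspace $C\subseteq(\mathbb C^D)^{\otimes n}$ such that for every error operator $E=E_1\otimes\cdots\otimes E_n$ of weight less than $d$ (i.e. with $E_i\ne\mathbb 1$ for fewer than $d$ indices $i$) there is a constant $c_E\in\mathbb C$ with $\langle\psi|E|\varphi\rangle=c_E\langle\psi|\varphi\rangle$ for all $\psi,\varphi\in C$. It is a QMDS code if it attains the quantum Singleton bound, $K=D^{\,n-2(d-1)}$. An encoding isometry of $C$ is a linear isometry $V\colon\mathbb C^K\to(\mathbb C^D)^{\otimes n}$ with range $C$. A maximally entangled state in $\mathbb C^K\otimes\mathbb C^K$ is a unit vector both of whose one-party reductions equal $\frac1K\mathbb 1$. **Theorem.** Let $C_1$ be an $((n_1,K,d_1))_{D_1}$ QMDS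 code and $C_2$ an $((n_2,K,d_2))_{D_2}$ QMDS code with the same $K>1$. Put $r_1=d_1-1$, $r_2=d_2-1$ and $$l=\min\left(n_1-r_1,\;n_2-r_2,\;r_1+r_2+1\right).$$ Then for all encoding isometries $V_1$ of $C_1$ and $V_2$ of $C_2$ and every maximally entangled state $\phi\in\mathbb C^K\otimes\mathbb C^K$, the vector $(V_1\otimes V_2)\phi$ is an $l$-uniform state in $(\mathbb C^{D_1})^{\otimes n_1}\otimes(\mathbb C^{D_2})^{\otimes n_2}$, regarded as a system of $n_1+n_2$ parties. In particular, an $l$-uniform state exists in this space. -/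

import Mathlib

open scoped BigOperators ComplexConjugate

noncomputable section

namespace QUniform

/-- Labels of the computational basis of a system whose parties are indexed by `ι`, party `i`
having local dimension `d i`: one basis label for each party. -/
abbrev Config {ι : Type} (d : ι → ℕ) : Type := (i : ι) → Fin (d i)

/-- The Hilbert space `⨂ i, ℂ^(d i)`, written in the computational basis: a vector is its family
of amplitudes, and the inner product is the standard one. -/
abbrev Space {ι : Type} [Fintype ι] [DecidableEq ι] (d : ι → ℕ) : Type :=
  EuclideanSpace ℂ (Config d)

/-- The `n`-fold tensor power of `ℂ^D`. -/
abbrev Power (n D : ℕ) : Type := Space (fun _ : Fin n => D)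

/-- The Hilbert space `(ℂ^D₁)^{⊗ n₁} ⊗ (ℂ^D₂)^{⊗ n₂}` of `n₁ + n₂` parties. -/
abbrev Power₂ (n₁ D₁ n₂ D₂ : ℕ) : Type :=
  Space (Sum.elim (fun _ : Fin n₁ => D₁) (fun _ : Fin n₂ => D₂))

/-- The space `ℂ^K ⊗ ℂ^L` of two parties, in the computational basis `|i⟩ ⊗ |j⟩`. -/
abbrev Bipartite (K L : ℕ) : Type := EuclideanSpace ℂ (Fin K × Fin L)

/-- The operator `|ψ⟩⟨ψ|`. -/
def ketBra {m : Type} [Fintype m] (ψ : EuclideanSpace ℂ m) : Matrix m m ℂ :=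
  fun x y => ψ x * conj (ψ y)

section Uniform

variable {ι : Type} [Fintype ι] [DecidableEq ι] {d : ι → ℕ}

/-- The configuration that is `x` on the parties in `S` and `z` on the other parties. -/
def glue (S : Finset ι) (x : (i : {i // i ∈ S}) → Fin (d i))
    (z : (i : {i // i ∉ S}) → Fin (d i)) : Config d :=
  fun i => if h : i ∈ S then x ⟨i, h⟩ else z ⟨i, h⟩

/-- The reduction of an operator to the parties in `S`: the partial trace over the complement
of `S`. -/
def reduction (S : Finset ι) (ρ : Matrix (Config d) (Config d) ℂ) :
    Matrix ((i : {i // i ∈ S}) → Fin (d i)) ((i : {i // i ∈ S}) → Fin (d i)) ℂ :=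
  fun x y => ∑ z : (i : {i // i ∉ S}) → Fin (d i), ρ (glue S x z) (glue S y z)

/-- `ψ` is an `r`-uniform state: a unit vector all of whose reductions to `r` parties are
maximally mixed. (`r` is at most the number of parties, so there are such reductions.) -/
def IsUniform (r : ℕ) (ψ : Space d) : Prop :=
  ‖ψ‖ = 1 ∧ r ≤ Fintype.card ι ∧
    ∀ S : Finset ι, S.card = r →
      reduction S (ketBra ψ) = (∏ i ∈ S, (d i : ℂ))⁻¹ • 1

end Uniform

section Codes

/-- The matrix of the product operator `A 0 ⊗ ⋯ ⊗ A (n-1)` in the computational basis. -/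
def errorMatrix {n D : ℕ} (A : Fin n → Matrix (Fin D) (Fin D) ℂ) :
    Matrix (Config fun _ : Fin n => D) (Config fun _ : Fin n => D) ℂ :=
  Matrix.of fun x y => ∏ i, A i (x i) (y i)

/-- The product error operator `A 0 ⊗ ⋯ ⊗ A (n-1)` on `(ℂ^D)^{⊗ n}`. -/
def errorOp {n D : ℕ} (A : Fin n → Matrix (Fin D) (Fin D) ℂ) : Power n D →ₗ[ℂ] Power n D :=
  Matrix.toEuclideanLin (errorMatrix A)

/-- The weight of a product error operator: the number of parties on which it acts
nontrivially. -/
def weight {n D : ℕ} (A : Fin n → Matrix (Fin D) (Fin D) ℂ) : ℕ :=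
  Set.ncard {i | A i ≠ 1}

/-- `C` is the code space of a (not necessarily pure) `((n, K, d))_D` quantum error correcting
code: a `K`-dimensional subspace satisfying the Knill-Laflamme conditions for the detection of
all errors of weight less than `d`. (Errors of weight less than `d`
are linear combinations of product errors of weight less than `d`.) -/
structure IsCode (n K d D : ℕ) (C : Submodule ℂ (Power n D)) : Prop where
  one_le_dist : 1 ≤ d
  finrank_eq : Module.finrank ℂ C = K
  detects : ∀ A : Fin n → Matrix (Fin D) (Fin D) ℂ, weight A < d →
    ∃ c : ℂ, ∀ ψ ∈ C, ∀ φ ∈ C, inner ℂ ψ (errorOp A φ) = c * inner ℂ ψ φ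

/-- A quantum maximum distance separable code: the quantum Singleton bound
`K ≤ D^(n-2(d-1))` is attained (the exponent is an integer). -/
structure IsQMDS (n K d D : ℕ) (C : Submodule ℂ (Power n D)) : Prop extends
    IsCode n K d D C where
  singleton_eq : (K : ℝ) = (D : ℝ) ^ ((n : ℤ) - 2 * ((d : ℤ) - 1))

/-- `V` is an encoding isometry of the code `C`: an isometry of `ℂ^K` with range `C`. -/
def IsEncoding {n K D : ℕ} (C : Submodule ℂ (Power n D))
    (V : EuclideanSpace ℂ (Fin K) →ₗᵢ[ℂ] Power n D) : Prop :=
  LinearMap.range V.toLinearMap = C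

end Codes

section Bipartite

/-- The reduction of an operator on a bipartite system to the first party. -/
def traceRight {K L : ℕ} (ρ : Matrix (Fin K × Fin L) (Fin K × Fin L) ℂ) :
    Matrix (Fin K) (Fin K) ℂ :=
  fun i j => ∑ k, ρ (i, k) (j, k)

/-- The reduction of an operator on a bipartite system to the second party. -/
def traceLeft {K L : ℕ} (ρ : Matrix (Fin K × Fin L) (Fin K × Fin L) ℂ) :
    Matrix (Fin L) (Fin L) ℂ :=
  fun i j => ∑ k, ρ (k, i) (k, j)

/-- `φ` is a maximally entangled state in `ℂ^K ⊗ ℂ^K`: a unit vector whose two reductions are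
maximally mixed. -/
def IsMaximallyEntangled {K : ℕ} (φ : Bipartite K K) : Prop :=
  ‖φ‖ = 1 ∧ traceRight (ketBra φ) = (K : ℂ)⁻¹ • 1 ∧ traceLeft (ketBra φ) = (K : ℂ)⁻¹ • 1

/-- The product vector `a ⊗ b` in `ℂ^K ⊗ ℂ^L`. -/
def pairTensor {K L : ℕ} (a : EuclideanSpace ℂ (Fin K)) (b : EuclideanSpace ℂ (Fin L)) :
    Bipartite K L :=
  WithLp.toLp 2 fun p => a p.1 * b p.2

/-- The restriction of a configuration of all `n₁ + n₂` parties to the first `n₁` parties. -/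
def leftPart {n₁ D₁ n₂ D₂ : ℕ}
    (x : Config (Sum.elim (fun _ : Fin n₁ => D₁) (fun _ : Fin n₂ => D₂))) :
    Config (fun _ : Fin n₁ => D₁) :=
  fun i => x (Sum.inl i)

/-- The restriction of a configuration of all `n₁ + n₂` parties to the last `n₂` parties. -/
def rightPart {n₁ D₁ n₂ D₂ : ℕ}
    (x : Config (Sum.elim (fun _ : Fin n₁ => D₁) (fun _ : Fin n₂ => D₂))) :
    Config (fun _ : Fin n₂ => D₂) :=
  fun j => x (Sum.inr j)

/-- The product vector `ψ ⊗ χ` of two multipartite vectors, in the space of all the parties. -/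
def tensorVec {n₁ D₁ n₂ D₂ : ℕ} (ψ : Power n₁ D₁) (χ : Power n₂ D₂) : Power₂ n₁ D₁ n₂ D₂ :=
  WithLp.toLp 2 fun x => ψ (leftPart x) * χ (rightPart x)

/-- The operator `V₁ ⊗ V₂`, the linear map with `|i⟩ ⊗ |j⟩ ↦ V₁|i⟩ ⊗ V₂|j⟩`. -/
def tensorMap {K L n₁ D₁ n₂ D₂ : ℕ} (V₁ : EuclideanSpace ℂ (Fin K) →ₗᵢ[ℂ] Power n₁ D₁)
    (V₂ : EuclideanSpace ℂ (Fin L) →ₗᵢ[ℂ] Power n₂ D₂) :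
    Bipartite K L →ₗ[ℂ] Power₂ n₁ D₁ n₂ D₂ where
  toFun φ := ∑ p : Fin K × Fin L, φ p •
    tensorVec (V₁ (EuclideanSpace.single p.1 1)) (V₂ (EuclideanSpace.single p.2 1))
  map_add' φ χ := by simp [add_smul, Finset.sum_add_distrib]
  map_smul' c φ := by simp [mul_smul, Finset.smul_sum]

/-- `V₁ ⊗ V₂` acts on product vectors as it should. -/
theorem tensorMap_pairTensor {K L n₁ D₁ n₂ D₂ : ℕ}
    (V₁ : EuclideanSpace ℂ (Fin K) →ₗᵢ[ℂ] Power n₁ D₁)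
    (V₂ : EuclideanSpace ℂ (Fin L) →ₗᵢ[ℂ] Power n₂ D₂)
    (a : EuclideanSpace ℂ (Fin K)) (b : EuclideanSpace ℂ (Fin L)) :
    tensorMap V₁ V₂ (pairTensor a b) = tensorVec (V₁ a) (V₂ b) := by
  have ha : ∀ y, V₁ a y = ∑ i, a i * V₁ (EuclideanSpace.single i 1) y := by
    intro y
    conv_lhs => rw [← (EuclideanSpace.basisFun (Fin K) ℂ).sum_repr a]
    simp
  have hb : ∀ y, V₂ b y = ∑ i, b i * V₂ (EuclideanSpace.single i 1) y := by
    intro y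
    conv_lhs => rw [← (EuclideanSpace.basisFun (Fin L) ℂ).sum_repr b]
    simp
  ext x
  simp only [tensorMap, tensorVec, pairTensor, LinearMap.coe_mk, AddHom.coe_mk,
    WithLp.ofLp_sum, WithLp.ofLp_smul, Finset.sum_apply, Pi.smul_apply, smul_eq_mul,
    Fintype.sum_prod_type]
  rw [ha, hb, Finset.sum_mul_sum]
  exact Finset.sum_congr rfl fun i _ => Finset.sum_congr rfl fun j _ => by ring

end Bipartite

end QUniform

end

/-!
Write `|ψ_k⟩` for an orthonormal basis of a code and `R_T` for the reduction of `∑ k, |ψ_k⟩⟨ψ_k|` to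
a set `T` of parties; `k` plays the role of a reference system of dimension `K`. Put `r = d - 1`.

The heart of the proof is that a QMDS code is pure, that is, `R_T` is a multiple of the identity
whenever `|T| ≤ n - r` (`IsQMDS.isScalarOn`). Entropies are not needed for this, purities suffice.
By the Knill–Laflamme conditions (`IsCode.exists_trOut`) a set `A` of `r` parties is uncorrelated
with the reference, so `K ‖R_{Aᶜ}‖² = ‖R_A‖²` in the Hilbert–Schmidt norm
(`card_mul_hsq_trOut_compl`). If `B` is another set of `r` parties, disjoint from `A`, and `C` is the
rest, then `R_B ⊗ 1_C / dim C` is the orthogonal projection of `R_{Aᶜ}` onto the operators acting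
trivially on `C`, so `‖R_B‖² ≤ dim C * ‖R_{Aᶜ}‖²`, with equality only if `R_{Aᶜ} = R_B ⊗ 1_C / dim C`
(`hsq_sub_extendOne`). The Singleton equality says `dim C = K`; hence `‖R_B‖ ≤ ‖R_A‖`, and by symmetry
equality holds throughout (`trOut_compl_eq_extendOne`). Since `dim C = K > 1`, every party of `Aᶜ`
lies in `C` for some choice of `B`, so `R_{Aᶜ}` is maximally mixed (`isScalarOn_of_forall_agree`).

Let now `S = S₁ ∪ S₂` be a set of `l` parties of the combined system. By the third term of the
minimum `|S₁| ≤ r₁` or `|S₂| ≤ r₂`. In the first case the reduction of `V₁` to `S₁` and the reference is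
a product, so the entangled state `φ` hands a maximally mixed input to `V₂`, and the reduction to `S`
is `R_{S₁} ⊗ R_{S₂}` up to a scalar; both factors are maximally mixed by purity. The second case is
symmetric (`IsQMDS.isUniform_tensorMap`).

Partial traces are written as sums over configurations of all parties (`trOut`), so that reductions
to different sets of parties are matrices of the same type. They differ from `reduction` by the
dimension of the parties kept; constants never have to be followed, because the normalization of a
scalar reduction is recovered from the trace (`IsScalarOn.trOut_eq`).
-/

open scoped BigOperators ComplexConjugate

namespace QUniform

/-! ### Partial traces over full configurations -/

section PartialTrace

variable {ι : Type} [Fintype ι] [DecidableEq ι] {d : ι → ℕ}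

/-- Exchanging the `T`-parts of two configurations permutes the pairs of configurations. -/
theorem sum_piecewise_swap (T : Finset ι) (F : Config d → Config d → ℂ) :
    ∑ x, ∑ w, F (T.piecewise x w) (T.piecewise w x) = ∑ x, ∑ w, F x w := by
  have hinv : Function.Involutive (fun p : Config d × Config d =>
      (T.piecewise p.1 p.2, T.piecewise p.2 p.1)) := by
    rintro ⟨x, w⟩
    refine Prod.ext ?_ ?_ <;> funext i <;> by_cases h : i ∈ T <;> simp [Finset.piecewise, h]
  have := Equiv.sum_comp hinv.toPerm (fun p : Config d × Config d => F p.1 p.2)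
  simpa [Fintype.sum_prod_type] using this

theorem sum_sum_piecewise (T : Finset ι) (F : Config d → ℂ) :
    ∑ u, ∑ w, F (T.piecewise u w) = Fintype.card (Config d) * ∑ x, F x := by
  rw [sum_piecewise_swap T fun x _ => F x]
  simp [Finset.mul_sum]

/-- The configurations that agree with `x` on `C` are free on the other parties. -/
theorem card_agree (C : Finset ι) (x : Config d) :
    (∏ i ∈ C, d i) * (Finset.univ.filter fun y : Config d => ∀ i ∈ C, x i = y i).card =
      Fintype.card (Config d) := by
  have h : (Finset.univ.filter fun y : Config d => ∀ i ∈ C, x i = y i) =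
      Fintype.piFinset fun i => if i ∈ C then {x i} else Finset.univ := by
    ext y
    simp only [Finset.mem_filter_univ, Fintype.mem_piFinset]
    refine forall_congr' fun i => ?_
    by_cases hi : i ∈ C <;> simp [hi, eq_comm]
  rw [h, Fintype.card_piFinset, Fintype.card_pi, ← Finset.prod_mul_prod_compl C,
    ← Finset.prod_mul_prod_compl C]
  have h1 : ∏ i ∈ C, (if i ∈ C then {x i} else (Finset.univ : Finset (Fin (d i)))).card = 1 :=
    Finset.prod_eq_one fun i hi => by simp [hi]
  have h2 : ∏ i ∈ Cᶜ, (if i ∈ C then {x i} else (Finset.univ : Finset (Fin (d i)))).card =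
      ∏ i ∈ Cᶜ, d i := Finset.prod_congr rfl fun i hi => by simp [Finset.mem_compl.mp hi]
  rw [h1, h2]
  simp

/-- Summing over the configurations that agree with `x` on `C` is, up to the dimension of `C`,
resetting the parties in `C` to `x`. -/
theorem sum_agree (C : Finset ι) (x : Config d) (F : Config d → ℂ) :
    (∏ i ∈ C, (d i : ℂ)) * ∑ y, (if ∀ i ∈ C, x i = y i then F y else 0) =
      ∑ y, F (C.piecewise x y) := by
  have hX : (Fintype.card (Config d) : ℂ) ≠ 0 := by
    have : Nonempty (Config d) := ⟨x⟩
    exact_mod_cast Fintype.card_ne_zero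
  refine mul_left_cancel₀ hX ?_
  have h1 := sum_sum_piecewise C fun y => if ∀ i ∈ C, x i = y i then F y else 0
  have h2 : ∀ u w : Config d, (if ∀ i ∈ C, x i = C.piecewise u w i then F (C.piecewise u w) else 0) =
      if ∀ i ∈ C, x i = u i then F (C.piecewise x w) else 0 := by
    intro u w
    have : (∀ i ∈ C, x i = C.piecewise u w i) ↔ ∀ i ∈ C, x i = u i :=
      forall₂_congr fun i hi => by simp [hi]
    rw [if_congr this rfl rfl]
    split_ifs with h
    · congr 1
      funext i
      by_cases hi : i ∈ C <;> simp [hi, h]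
    · rfl
  simp only [h2] at h1
  rw [mul_left_comm, ← h1, Finset.sum_comm]
  simp only [Finset.sum_ite, Finset.sum_const_zero, add_zero, Finset.sum_const, nsmul_eq_mul,
    ← Finset.mul_sum]
  rw [← mul_assoc, ← card_agree C x]
  push_cast
  ring

/-- The partial trace of `M` over the parties outside `T`, as a matrix indexed by configurations
of *all* parties: its entries depend on the parties in `T` only, and every term of the partial
trace is counted `∏ i ∈ T, d i` times, because the sum is over configurations of all parties. -/
def trOut (T : Finset ι) (M : Matrix (Config d) (Config d) ℂ) :
    Matrix (Config d) (Config d) ℂ :=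
  fun x y => ∑ w, M (T.piecewise x w) (T.piecewise y w)

theorem trOut_congr {T : Finset ι} (M : Matrix (Config d) (Config d) ℂ) {x y x' y' : Config d}
    (hx : ∀ i ∈ T, x i = x' i) (hy : ∀ i ∈ T, y i = y' i) : trOut T M x y = trOut T M x' y' := by
  unfold trOut
  refine Finset.sum_congr rfl fun w _ => ?_
  rw [Finset.piecewise_congr T hx fun _ _ => rfl, Finset.piecewise_congr T hy fun _ _ => rfl]

theorem trOut_sum {κ : Type} [Fintype κ] (T : Finset ι)
    (M : κ → Matrix (Config d) (Config d) ℂ) (x y : Config d) :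
    trOut T (∑ k, M k) x y = ∑ k, trOut T (M k) x y := by
  simp only [trOut, Matrix.sum_apply]
  exact Finset.sum_comm

/-- Tracing out in two steps. -/
theorem sum_trOut {B T : Finset ι} (hBT : B ⊆ T) (M : Matrix (Config d) (Config d) ℂ)
    (x y : Config d) :
    ∑ u, trOut T M (B.piecewise x u) (B.piecewise y u) =
      Fintype.card (Config d) * trOut B M x y := by
  have h : ∀ z u w : Config d,
      T.piecewise (B.piecewise z u) w = B.piecewise z (T.piecewise u w) := by
    intro z u w
    funext i
    by_cases hB : i ∈ B
    · simp [hB, hBT hB]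
    · by_cases hT : i ∈ T <;> simp [hB, hT]
  simp only [trOut, h]
  exact sum_sum_piecewise T fun v => M (B.piecewise x v) (B.piecewise y v)

/-- The (scaled) reduction of `M` to the parties in `T` is a multiple of the identity. -/
def IsScalarOn (T : Finset ι) (M : Matrix (Config d) (Config d) ℂ) : Prop :=
  ∃ c : ℂ, ∀ x y, trOut T M x y = if ∀ i ∈ T, x i = y i then c else 0

theorem IsScalarOn.mono {B T : Finset ι} (hBT : B ⊆ T) {M : Matrix (Config d) (Config d) ℂ}
    (h : IsScalarOn T M) : IsScalarOn B M := by
  obtain ⟨c, hc⟩ := h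
  refine ⟨c, fun x y => ?_⟩
  have hX : (Fintype.card (Config d) : ℂ) ≠ 0 := by
    have : Nonempty (Config d) := ⟨x⟩
    exact_mod_cast Fintype.card_ne_zero
  refine mul_left_cancel₀ hX ?_
  rw [← sum_trOut hBT]
  have h : ∀ u : Config d, (∀ i ∈ T, B.piecewise x u i = B.piecewise y u i) ↔
      ∀ i ∈ B, x i = y i := by
    refine fun u => ⟨fun h i hi => by simpa [hi] using h i (hBT hi), fun h i _ => ?_⟩
    by_cases hi : i ∈ B <;> simp [hi, h]
  simp [hc, h]

/-- The normalization of a scalar reduction is determined by the trace. -/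
theorem IsScalarOn.trOut_eq {T : Finset ι} {M : Matrix (Config d) (Config d) ℂ}
    (h : IsScalarOn T M) (htr : M.trace = 1) (x y : Config d) :
    trOut T M x y = if ∀ i ∈ T, x i = y i then 1 else 0 := by
  obtain ⟨c, hc⟩ := h
  have hX : (Fintype.card (Config d) : ℂ) ≠ 0 := by
    have : Nonempty (Config d) := ⟨x⟩
    exact_mod_cast Fintype.card_ne_zero
  have h1 : ∑ x, trOut T M x x = Fintype.card (Config d) * M.trace :=
    sum_sum_piecewise T fun x => M x x
  have h2 : c = 1 := by
    simp only [hc, implies_true, if_true, Finset.sum_const, Finset.card_univ, nsmul_eq_mul, htr] at h1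
    exact mul_left_cancel₀ hX h1
  rw [hc, h2]

theorem trOut_eq_reduction (S : Finset ι) (M : Matrix (Config d) (Config d) ℂ) (x y : Config d) :
    trOut S M x y =
      (∏ i ∈ S, (d i : ℂ)) * reduction S M (fun i => x i) (fun i => y i) := by
  have hg : ∀ (z : Config d) (a : (i : {i // i ∈ S}) → Fin (d i))
      (b : (i : {i // i ∉ S}) → Fin (d i)),
      S.piecewise z (glue S a b) = glue S (fun i => z i) b := by
    intro z a b
    funext i
    by_cases hi : i ∈ S <;> simp [glue, hi]
  let e := Equiv.piEquivPiSubtypeProd (fun i => i ∈ S) fun i => Fin (d i)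
  have he : ∀ a b, e.symm (a, b) = glue S a b := fun a b => rfl
  unfold trOut reduction
  rw [← Equiv.sum_comp e.symm, Fintype.sum_prod_type]
  simp only [he, hg, Finset.sum_const, Finset.card_univ, nsmul_eq_mul]
  congr 1
  rw [Fintype.card_pi, ← Finset.prod_coe_sort S fun i => (d i : ℂ)]
  simp

/-- A unit vector all of whose `r`-party reductions are scalar is `r`-uniform. -/
theorem isUniform_of_isScalarOn {r : ℕ} {ψ : Space d} (hψ : ‖ψ‖ = 1) (hr : r ≤ Fintype.card ι)
    (h : ∀ S : Finset ι, S.card = r → IsScalarOn S (ketBra ψ)) : IsUniform r ψ := by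
  have htr : (ketBra ψ).trace = 1 := by
    have h1 : (inner ℂ ψ ψ : ℂ) = 1 := by rw [inner_self_eq_norm_sq_to_K, hψ]; simp
    rw [← h1, PiLp.inner_apply]
    rfl
  have hne : Nonempty (Config d) := by
    by_contra hne
    rw [not_nonempty_iff] at hne
    simp [Matrix.trace] at htr
  refine ⟨hψ, hr, fun S hS => ?_⟩
  obtain ⟨w⟩ := hne
  ext a b
  have key := trOut_eq_reduction S (ketBra ψ) (glue S a fun i => w i) (glue S b fun i => w i)
  have hres : ∀ a, (fun i : {i // i ∈ S} => glue S a (fun i => w i) i) = a := by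
    intro a; funext i; simp [glue]
  have hag : (∀ i ∈ S, glue S a (fun i => w i) i = glue S b (fun i => w i) i) ↔ a = b := by
    constructor
    · intro h; funext i; simpa [glue] using h i i.2
    · rintro rfl; simp
  rw [(h S hS).trOut_eq htr, hres, hres, if_congr hag rfl rfl] at key
  have hd : (∏ i ∈ S, (d i : ℂ)) ≠ 0 := by
    refine Finset.prod_ne_zero_iff.mpr fun i _ => ?_
    have := (w i).pos
    exact_mod_cast this.ne'
  rw [Matrix.smul_apply, smul_eq_mul, eq_inv_mul_iff_mul_eq₀ hd, ← key, Matrix.one_apply]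

end PartialTrace

/-! ### Purities of reductions -/

section Purity

variable {ι : Type} [Fintype ι] [DecidableEq ι] {d : ι → ℕ}

/-- The squared Hilbert–Schmidt norm. -/
def hsq {X : Type} [Fintype X] (M : Matrix X X ℂ) : ℝ := ∑ x, ∑ y, Complex.normSq (M x y)

theorem hsq_nonneg {X : Type} [Fintype X] (M : Matrix X X ℂ) : 0 ≤ hsq M :=
  Finset.sum_nonneg fun _ _ => Finset.sum_nonneg fun _ _ => Complex.normSq_nonneg _

theorem eq_zero_of_hsq_eq_zero {X : Type} [Fintype X] {M : Matrix X X ℂ} (h : hsq M = 0) (x y : X) :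
    M x y = 0 := by
  have h1 := (Finset.sum_eq_zero_iff_of_nonneg fun x _ =>
    Finset.sum_nonneg fun y _ => Complex.normSq_nonneg (M x y)).mp h x (Finset.mem_univ x)
  have h2 := (Finset.sum_eq_zero_iff_of_nonneg fun y _ =>
    Complex.normSq_nonneg (M x y)).mp h1 y (Finset.mem_univ y)
  exact Complex.normSq_eq_zero.mp h2

/-- `‖aᴴ a‖ = ‖a aᴴ‖` in the Hilbert–Schmidt norm. -/
theorem hsq_gram_comm {P X : Type} [Fintype P] [Fintype X] (a : P → X → ℂ) :
    hsq (fun x y => ∑ p, a p x * conj (a p y)) = hsq fun p q => ∑ x, a p x * conj (a q x) := by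
  have h : ∀ z : ℂ, (Complex.normSq z : ℂ) = z * conj z := fun z => (Complex.mul_conj z).symm
  apply Complex.ofReal_injective
  simp only [hsq, Complex.ofReal_sum, h, map_sum, Finset.sum_mul_sum, map_mul, Complex.conj_conj]
  simp only [← Fintype.sum_prod_type' (f := fun (_ : P) (_ : P) => (_ : ℂ)),
    ← Fintype.sum_prod_type' (f := fun (_ : X) (_ : X) => (_ : ℂ))]
  rw [Finset.sum_comm]
  exact Finset.sum_congr rfl fun p _ => Finset.sum_congr rfl fun x _ => by ring

/-- The matrix `|f⟩⟨g|`. -/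
def ketBraPair (f g : Config d → ℂ) : Matrix (Config d) (Config d) ℂ :=
  fun x y => f x * conj (g y)

/-- The two reductions of a pure state of a system and a reference `κ` have the same purity. -/
theorem hsq_trOut_compl {κ : Type} [Fintype κ] (A : Finset ι) (ψ : κ → Config d → ℂ) :
    hsq (trOut Aᶜ (∑ k, ketBraPair (ψ k) (ψ k))) =
      ∑ k, ∑ k', hsq (trOut A (ketBraPair (ψ k) (ψ k'))) := by
  have h := hsq_gram_comm fun (p : κ × Config d) x => ψ p.1 (A.piecewise p.2 x)
  have h1 : trOut Aᶜ (∑ k, ketBraPair (ψ k) (ψ k)) = fun x y =>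
      ∑ p : κ × Config d, ψ p.1 (A.piecewise p.2 x) * conj (ψ p.1 (A.piecewise p.2 y)) := by
    ext x y
    rw [trOut_sum, Fintype.sum_prod_type]
    simp [trOut, ketBraPair, Finset.piecewise_compl]
  rw [h1, h]
  simp only [hsq, Fintype.sum_prod_type]
  refine Finset.sum_congr rfl fun k _ => ?_
  rw [Finset.sum_comm]
  rfl

/-- Summing over the pairs of configurations that agree on `C` is, up to a factor, summing over a
common value `u` on `C`. -/
theorem sum_sum_agree (C : Finset ι) (h : Config d → Config d → ℂ) :
    (Fintype.card (Config d) : ℂ) * ((∏ i ∈ C, (d i : ℂ)) *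
        ∑ x, ∑ y, (if ∀ i ∈ C, x i = y i then h x y else 0)) =
      ∑ x, ∑ y, ∑ u, h (C.piecewise u x) (C.piecewise u y) := by
  rw [Finset.mul_sum, Finset.sum_congr rfl fun x _ => sum_agree C x (h x)]
  rw [← sum_sum_piecewise C fun x => ∑ y, h x (C.piecewise x y)]
  rw [Finset.sum_comm]
  refine Finset.sum_congr rfl fun x _ => ?_
  rw [Finset.sum_comm]
  refine Finset.sum_congr rfl fun y _ => Finset.sum_congr rfl fun u _ => ?_
  congr 1
  funext i
  by_cases hi : i ∈ C <;> simp [hi]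

/-- The reduction of `M` to `B`, tensored with the identity on `C`, in the convention of `trOut`:
a matrix indexed by configurations of all parties, whose entries depend on `B ∪ C` only. -/
def extendOne (B C : Finset ι) (M : Matrix (Config d) (Config d) ℂ) :
    Matrix (Config d) (Config d) ℂ :=
  fun x y => if ∀ i ∈ C, x i = y i then trOut B M x y else 0

/-- The reduction to `B`, tensored with the identity on `T \ B`, is the orthogonal projection of
the reduction to `T`, and this is Pythagoras' theorem for it. In the scaling of `trOut` the factor
`1 / dim (T \ B)` of the projection is absorbed. -/
theorem hsq_sub_extendOne {B T : Finset ι} (hBT : B ⊆ T) (M : Matrix (Config d) (Config d) ℂ) :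
    (∏ i ∈ T \ B, (d i : ℝ)) * hsq (trOut T M - extendOne B (T \ B) M) =
      (∏ i ∈ T \ B, (d i : ℝ)) * hsq (trOut T M) - hsq (trOut B M) := by
  by_cases hne : Nonempty (Config d)
  swap
  · rw [not_nonempty_iff] at hne
    simp [hsq]
  have hX : (Fintype.card (Config d) : ℂ) ≠ 0 := by exact_mod_cast Fintype.card_ne_zero
  set C := T \ B with hC
  have hB : ∀ u x i, i ∈ B → C.piecewise u x i = (x i : Fin (d i)) := by
    intro u x i hi
    simp [hC, hi]
  have hR : ∀ x y u : Config d, trOut B M (C.piecewise u x) (C.piecewise u y) = trOut B M x y :=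
    fun x y u => trOut_congr M (hB u x) (hB u y)
  have hT : ∀ x y u : Config d, trOut T M (C.piecewise u x) (C.piecewise u y) =
      trOut T M (B.piecewise x u) (B.piecewise y u) := by
    intro x y u
    have : ∀ z : Config d, ∀ i ∈ T, C.piecewise u z i = B.piecewise z u i := by
      intro z i hi
      by_cases hiB : i ∈ B <;> simp [hC, hi, hiB]
    exact trOut_congr M (this x) (this y)
  -- Both `⟨R_T, R_B ⊗ 1⟩` and `‖R_B ⊗ 1‖²` equal `‖R_B‖²` divided by the dimension of `C`.
  have cross : ∀ N : Matrix (Config d) (Config d) ℂ,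
      (∀ x y, ∑ u, N (C.piecewise u x) (C.piecewise u y) =
        Fintype.card (Config d) * trOut B M x y) →
      (∏ i ∈ C, (d i : ℂ)) *
        ∑ x, ∑ y, (if ∀ i ∈ C, x i = y i then N x y * conj (trOut B M x y) else 0) =
      (hsq (trOut B M) : ℂ) := by
    intro N hN
    refine mul_left_cancel₀ hX ?_
    rw [sum_sum_agree C fun x y => N x y * conj (trOut B M x y)]
    simp only [hR, ← Finset.sum_mul, hN, hsq, Complex.ofReal_sum, Finset.mul_sum,
      Complex.normSq_eq_conj_mul_self]
    refine Finset.sum_congr rfl fun x _ => Finset.sum_congr rfl fun y _ => by ring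
  have c1 := cross (trOut T M) fun x y => by simp only [hT, sum_trOut hBT]
  have c2 := cross (trOut B M) fun x y => by simp [hR]
  have hre : (∏ i ∈ C, (d i : ℂ)) = ((∏ i ∈ C, (d i : ℝ) : ℝ) : ℂ) := by push_cast; rfl
  rw [hre] at c1 c2
  have r1 := congrArg Complex.re c1
  have r2 := congrArg Complex.re c2
  rw [Complex.re_ofReal_mul, Complex.ofReal_re] at r1 r2
  have hpt : ∀ x y, Complex.normSq ((trOut T M - extendOne B C M) x y) =
      Complex.normSq (trOut T M x y)
      - 2 * (if ∀ i ∈ C, x i = y i then trOut T M x y * conj (trOut B M x y) else 0).re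
      + (if ∀ i ∈ C, x i = y i then trOut B M x y * conj (trOut B M x y) else 0).re := by
    intro x y
    rw [Matrix.sub_apply, Complex.normSq_sub, extendOne]
    split_ifs
    · rw [Complex.mul_conj (trOut B M x y), Complex.ofReal_re]; ring
    · simp
  have hsum : hsq (trOut T M - extendOne B C M) = hsq (trOut T M)
      - 2 * (∑ x, ∑ y, if ∀ i ∈ C, x i = y i then trOut T M x y * conj (trOut B M x y) else 0).re
      + (∑ x, ∑ y, if ∀ i ∈ C, x i = y i then trOut B M x y * conj (trOut B M x y) else 0).re := by
    simp only [hsq, hpt, Finset.sum_add_distrib, Finset.sum_sub_distrib, Finset.mul_sum,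
      Complex.re_sum]
  rw [hsum]
  linear_combination r2 - 2 * r1

/-- If every party of `T` is maximally mixed and uncorrelated with the rest of `T`, then the whole
reduction to `T` is scalar. -/
theorem isScalarOn_of_forall_agree {T : Finset ι} {M : Matrix (Config d) (Config d) ℂ}
    (h : ∀ i ∈ T, ∃ B ⊆ T, i ∉ B ∧ trOut T M = extendOne B (T \ B) M) : IsScalarOn T M := by
  by_cases hne : Nonempty (Config d)
  swap
  · rw [not_nonempty_iff] at hne
    exact ⟨0, fun x => isEmptyElim x⟩
  obtain ⟨o⟩ := hne
  have hupd : ∀ (x : Config d) i a,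
      trOut T M (Function.update x i a) (Function.update x i a) = trOut T M x x := by
    intro x i a
    by_cases hi : i ∈ T
    · obtain ⟨B, -, hiB, hEq⟩ := h i hi
      rw [hEq]
      simp only [extendOne, implies_true, if_true]
      have : ∀ j ∈ B, Function.update x i a j = x j := fun j hj =>
        Function.update_of_ne (ne_of_mem_of_not_mem hj hiB) _ _
      exact trOut_congr M this this
    · have : ∀ j ∈ T, Function.update x i a j = x j := fun j hj =>
        Function.update_of_ne (ne_of_mem_of_not_mem hj hi) _ _
      exact trOut_congr M this this
  have hdiag : ∀ x, trOut T M x x = trOut T M o o := by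
    intro x
    have : ∀ S : Finset ι, trOut T M (S.piecewise x o) (S.piecewise x o) = trOut T M o o := by
      intro S
      induction S using Finset.induction_on with
      | empty => simp
      | insert i S _ ih => rw [Finset.piecewise_insert, hupd, ih]
    simpa using this Finset.univ
  refine ⟨trOut T M o o, fun x y => ?_⟩
  split_ifs with hxy
  · rw [← hdiag x]
    exact trOut_congr M (fun _ _ => rfl) fun i hi => (hxy i hi).symm
  · push Not at hxy
    obtain ⟨i, hi, hne⟩ := hxy
    obtain ⟨B, -, hiB, hEq⟩ := h i hi
    rw [hEq, extendOne, if_neg]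
    exact fun hall => hne (hall i (Finset.mem_sdiff.mpr ⟨hi, hiB⟩))

end Purity

/-! ### Purity of QMDS codes -/

section QMDS

variable {ι : Type} [Fintype ι] [DecidableEq ι] {d : ι → ℕ}

theorem hsq_smul {X : Type} [Fintype X] (c : ℂ) (M : Matrix X X ℂ) :
    hsq (c • M) = Complex.normSq c * hsq M := by
  simp [hsq, Finset.mul_sum]

/-- If the reference `κ` is uncorrelated with `A`, the purity of the reduction to `Aᶜ` is that of
the reduction to `A` divided by the dimension of the reference. -/
theorem card_mul_hsq_trOut_compl {κ : Type} [Fintype κ] [DecidableEq κ] {A : Finset ι}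
    {ψ : κ → Config d → ℂ} {g : Matrix (Config d) (Config d) ℂ}
    (hg : ∀ k k', trOut A (ketBraPair (ψ k) (ψ k')) = if k = k' then g else 0) :
    Fintype.card κ * hsq (trOut Aᶜ (∑ k, ketBraPair (ψ k) (ψ k))) =
      hsq (trOut A (∑ k, ketBraPair (ψ k) (ψ k))) := by
  have h0 : hsq (0 : Matrix (Config d) (Config d) ℂ) = 0 := by simp [hsq]
  have h1 : trOut A (∑ k, ketBraPair (ψ k) (ψ k)) = (Fintype.card κ : ℂ) • g := by
    ext x y
    rw [trOut_sum]
    simp [hg]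
  rw [hsq_trOut_compl, h1, hsq_smul]
  simp [hg, apply_ite hsq, h0, mul_assoc]

/-- The Hilbert–Schmidt form of the equality case of the quantum Singleton bound: if `A` and `B`
are disjoint, both uncorrelated with the reference, and the remaining parties have the
dimension of the reference, then the reduction to `Aᶜ` is maximally mixed outside `B`. -/
theorem trOut_compl_eq_extendOne {κ : Type} [Fintype κ] [DecidableEq κ] [Nonempty κ]
    {A B : Finset ι} (hAB : Disjoint A B) {ψ : κ → Config d → ℂ}
    {gA gB : Matrix (Config d) (Config d) ℂ}
    (hA : ∀ k k', trOut A (ketBraPair (ψ k) (ψ k')) = if k = k' then gA else 0)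
    (hB : ∀ k k', trOut B (ketBraPair (ψ k) (ψ k')) = if k = k' then gB else 0)
    (hdim : ∏ i ∈ Aᶜ \ B, d i = Fintype.card κ) :
    trOut Aᶜ (∑ k, ketBraPair (ψ k) (ψ k)) =
      extendOne B (Aᶜ \ B) (∑ k, ketBraPair (ψ k) (ψ k)) := by
  have hκ : (0 : ℝ) < Fintype.card κ := by exact_mod_cast Fintype.card_pos
  have hBA : Bᶜ \ A = Aᶜ \ B := by
    ext i; simp [and_comm]
  have hdim' : (∏ i ∈ Aᶜ \ B, (d i : ℝ)) = Fintype.card κ := by exact_mod_cast hdim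
  have h1 := hsq_sub_extendOne (Finset.subset_compl_iff_disjoint_left.mpr hAB)
    (∑ k, ketBraPair (ψ k) (ψ k))
  have h2 := hsq_sub_extendOne (Finset.subset_compl_iff_disjoint_left.mpr hAB.symm)
    (∑ k, ketBraPair (ψ k) (ψ k))
  rw [hdim', card_mul_hsq_trOut_compl hA] at h1
  rw [hBA, hdim', card_mul_hsq_trOut_compl hB] at h2
  have n1 := hsq_nonneg (trOut Aᶜ (∑ k, ketBraPair (ψ k) (ψ k)) -
    extendOne B (Aᶜ \ B) (∑ k, ketBraPair (ψ k) (ψ k)))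
  have n2 := mul_nonneg hκ.le (hsq_nonneg (trOut Bᶜ (∑ k, ketBraPair (ψ k) (ψ k)) -
    extendOne A (Aᶜ \ B) (∑ k, ketBraPair (ψ k) (ψ k))))
  have hzero : hsq (trOut Aᶜ (∑ k, ketBraPair (ψ k) (ψ k)) -
      extendOne B (Aᶜ \ B) (∑ k, ketBraPair (ψ k) (ψ k))) = 0 := by
    refine le_antisymm (le_of_mul_le_mul_left ?_ hκ) n1
    linarith
  ext x y
  exact sub_eq_zero.mp (eq_zero_of_hsq_eq_zero hzero x y)

/-- The product of the matrix units `|y i⟩⟨x i|` on the parties in `S`. -/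
theorem errorMatrix_single {n D : ℕ} (S : Finset (Fin n)) (x y u v : Config fun _ : Fin n => D) :
    errorMatrix (fun i => if i ∈ S then Matrix.single (y i) (x i) 1 else 1) u v =
      if v = S.piecewise x u then (if ∀ i ∈ S, y i = u i then 1 else 0) else 0 := by
  rw [errorMatrix, Matrix.of_apply, ← ite_and]
  split_ifs with h
  · obtain ⟨rfl, hu⟩ := h
    refine Finset.prod_eq_one fun i _ => ?_
    by_cases hi : i ∈ S <;> simp [hi, hu, Matrix.one_apply]
  · rw [Finset.prod_eq_zero_iff]
    by_contra hne
    push Not at hne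
    refine h ⟨funext fun i => ?_, fun i hi => ?_⟩
    · have := hne i (Finset.mem_univ i)
      by_cases hi : i ∈ S
      · simp only [hi, if_true, Matrix.single_apply] at this
        simp only [hi, Finset.piecewise_eq_of_mem]
        by_contra hv
        exact this (if_neg fun h => hv h.2.symm)
      · simp only [hi, if_false, Matrix.one_apply] at this
        simp only [hi, not_false_eq_true, Finset.piecewise_eq_of_notMem]
        by_contra hv
        exact this (if_neg fun h => hv h.symm)
    · have := hne i (Finset.mem_univ i)
      simp only [hi, if_true, Matrix.single_apply] at this
      by_contra hv
      exact this (if_neg fun h => hv h.1)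

/-- The Knill–Laflamme conditions for the matrix units on `S`: the parties in `S` are uncorrelated
with the encoded system. -/
theorem IsCode.exists_trOut {n K d D : ℕ} {C : Submodule ℂ (Power n D)} (h : IsCode n K d D C)
    {S : Finset (Fin n)} (hS : S.card < d) :
    ∃ g : Matrix (Config fun _ : Fin n => D) (Config fun _ : Fin n => D) ℂ,
      ∀ ψ ∈ C, ∀ φ ∈ C, trOut S (ketBraPair φ ψ) = (inner ℂ ψ φ : ℂ) • g := by
  have hw : ∀ x y : Config fun _ : Fin n => D,
      weight (fun i => if i ∈ S then Matrix.single (y i) (x i) (1 : ℂ) else 1) < d := by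
    intro x y
    refine lt_of_le_of_lt ?_ hS
    rw [weight, ← Set.ncard_coe_finset]
    refine Set.ncard_le_ncard (fun i hi => ?_) S.finite_toSet
    by_contra hiS
    exact hi (if_neg hiS)
  choose c hc using fun x y => h.detects _ (hw x y)
  refine ⟨Matrix.of fun x y => (D : ℂ) ^ S.card * c x y, fun ψ hψ φ hφ => ?_⟩
  ext x y
  have key := hc x y ψ hψ φ hφ
  have h1 : inner ℂ ψ (errorOp (fun i => if i ∈ S then Matrix.single (y i) (x i) (1 : ℂ) else 1) φ)
      = ∑ u, if ∀ i ∈ S, y i = u i then φ (S.piecewise x u) * conj (ψ u) else 0 := by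
    rw [PiLp.inner_apply]
    refine Finset.sum_congr rfl fun u _ => ?_
    simp only [errorOp, Matrix.toLpLin_apply, Matrix.mulVec, dotProduct, errorMatrix_single,
      RCLike.inner_apply]
    simp
  have h2 := sum_agree S y fun u => φ (S.piecewise x u) * conj (ψ u)
  have h3 : (∏ _i ∈ S, (D : ℂ)) * (c x y * inner ℂ ψ φ) =
      ∑ u, φ (S.piecewise x (S.piecewise y u)) * conj (ψ (S.piecewise y u)) := by
    rw [← key, h1]
    convert h2
  rw [Matrix.smul_apply, Matrix.of_apply, smul_eq_mul]
  simp only [Finset.prod_const] at h3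
  rw [mul_comm, mul_assoc, h3]
  simp [trOut, ketBraPair]

theorem IsCode.exists_trOut_orthonormal {n K d D : ℕ} {C : Submodule ℂ (Power n D)}
    (h : IsCode n K d D C) {S : Finset (Fin n)} (hS : S.card < d) {κ : Type} [DecidableEq κ]
    {e : κ → Power n D} (he : Orthonormal ℂ e) (heC : ∀ k, e k ∈ C) :
    ∃ g : Matrix (Config fun _ : Fin n => D) (Config fun _ : Fin n => D) ℂ,
      ∀ k k', trOut S (ketBraPair (e k) (e k')) = if k = k' then g else 0 := by
  obtain ⟨g, hg⟩ := h.exists_trOut hS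
  refine ⟨g, fun k k' => ?_⟩
  rw [hg _ (heC k') _ (heC k), orthonormal_iff_ite.mp he]
  by_cases hk : k = k' <;> simp [hk, eq_comm]

/-- For a nontrivial QMDS code the Singleton exponent is a positive natural number. -/
theorem IsQMDS.two_mul_lt_and_eq_pow {n K d D : ℕ} {C : Submodule ℂ (Power n D)} (h : IsQMDS n K d D C)
    (hK : 1 < K) : 2 * (d - 1) < n ∧ K = D ^ (n - 2 * (d - 1)) := by
  have hd := h.one_le_dist
  have hs := h.singleton_eq
  have hK' : (1 : ℝ) < K := by exact_mod_cast hK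
  have hlt : 2 * (d - 1) < n := by
    by_contra hle
    push Not at hle
    obtain ⟨m, hm⟩ : ∃ m : ℕ, ((n : ℤ) - 2 * ((d : ℤ) - 1)) = -(m : ℤ) :=
      ⟨2 * (d - 1) - n, by omega⟩
    rw [hm, zpow_neg, zpow_natCast] at hs
    rcases Nat.eq_zero_or_pos D with rfl | hD
    · rcases Nat.eq_zero_or_pos m with rfl | hm0
      · simp at hs; linarith
      · simp [hm0.ne'] at hs; linarith
    · have : (1 : ℝ) ≤ (D : ℝ) ^ m := one_le_pow₀ (by exact_mod_cast hD)
      have := inv_le_one_of_one_le₀ this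
      linarith
  refine ⟨hlt, ?_⟩
  have : ((n : ℤ) - 2 * ((d : ℤ) - 1)) = ((n - 2 * (d - 1) : ℕ) : ℤ) := by omega
  rw [this, zpow_natCast] at hs
  exact_mod_cast hs

/-- The code projector of a nontrivial QMDS code has maximally mixed reductions to all sets
of at most `n - (d - 1)` parties. -/
theorem IsQMDS.isScalarOn {n K d D : ℕ} {C : Submodule ℂ (Power n D)} (h : IsQMDS n K d D C)
    (hK : 1 < K) {e : Fin K → Power n D} (he : Orthonormal ℂ e) (heC : ∀ k, e k ∈ C)
    {T : Finset (Fin n)} (hT : T.card ≤ n - (d - 1)) :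
    IsScalarOn T (∑ k, ketBraPair (e k) (e k)) := by
  obtain ⟨hlt, hcard⟩ := h.two_mul_lt_and_eq_pow hK
  have hd := h.one_le_dist
  have : Nonempty (Fin K) := ⟨⟨0, by omega⟩⟩
  obtain ⟨U, hTU, hU⟩ := Finset.exists_superset_card_eq hT (by simp)
  refine IsScalarOn.mono hTU (isScalarOn_of_forall_agree fun i hi => ?_)
  -- Any party of `U` can be kept out of `B`, since `U` has more than `d - 1` parties.
  obtain ⟨B, hB, hBcard⟩ := Finset.exists_subset_card_eq (s := U.erase i) (n := d - 1)
    (by rw [Finset.card_erase_of_mem hi]; omega)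
  have hBU : B ⊆ U := hB.trans (Finset.erase_subset _ _)
  refine ⟨B, hBU, fun hiB => Finset.notMem_erase i U (hB hiB), ?_⟩
  have hUc : Uᶜ.card = d - 1 := by rw [Finset.card_compl, Fintype.card_fin]; omega
  obtain ⟨gA, hgA⟩ := h.exists_trOut_orthonormal (S := Uᶜ) (by omega) he heC
  obtain ⟨gB, hgB⟩ := h.exists_trOut_orthonormal (S := B) (by omega) he heC
  have hdim : ∏ _i ∈ Uᶜᶜ \ B, D = Fintype.card (Fin K) := by
    rw [compl_compl, Finset.prod_const, Finset.card_sdiff_of_subset hBU, Fintype.card_fin, hcard]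
    congr 1
    omega
  have key := trOut_compl_eq_extendOne
    (disjoint_compl_left.mono_right hBU) hgA hgB hdim
  rwa [compl_compl] at key

end QMDS

/-! ### Encoding a maximally entangled state by two codes -/

section Concatenation

theorem sum_config_elim {n₁ D₁ n₂ D₂ : ℕ}
    (f : Config (fun _ : Fin n₁ => D₁) → ℂ) (g : Config (fun _ : Fin n₂ => D₂) → ℂ) :
    ∑ w : Config (Sum.elim (fun _ : Fin n₁ => D₁) (fun _ : Fin n₂ => D₂)),
      f (leftPart w) * g (rightPart w) = (∑ w, f w) * ∑ w, g w := by
  rw [← Equiv.sum_comp (Equiv.sumPiEquivProdPi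
    fun i => Fin (Sum.elim (fun _ : Fin n₁ => D₁) (fun _ : Fin n₂ => D₂) i)).symm,
    Fintype.sum_prod_type, Finset.sum_mul_sum]
  rfl

theorem leftPart_piecewise {n₁ D₁ n₂ D₂ : ℕ} (S : Finset (Fin n₁ ⊕ Fin n₂))
    (x w : Config (Sum.elim (fun _ : Fin n₁ => D₁) (fun _ : Fin n₂ => D₂))) :
    leftPart (S.piecewise x w) = S.toLeft.piecewise (leftPart x) (leftPart w) := by
  funext i
  by_cases hi : Sum.inl i ∈ S <;> simp [leftPart, Finset.piecewise, hi] <;> rfl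

theorem rightPart_piecewise {n₁ D₁ n₂ D₂ : ℕ} (S : Finset (Fin n₁ ⊕ Fin n₂))
    (x w : Config (Sum.elim (fun _ : Fin n₁ => D₁) (fun _ : Fin n₂ => D₂))) :
    rightPart (S.piecewise x w) = S.toRight.piecewise (rightPart x) (rightPart w) := by
  funext i
  by_cases hi : Sum.inr i ∈ S <;> simp [rightPart, Finset.piecewise, hi] <;> rfl

theorem tensorMap_apply {K L n₁ D₁ n₂ D₂ : ℕ} (V₁ : EuclideanSpace ℂ (Fin K) →ₗᵢ[ℂ] Power n₁ D₁)
    (V₂ : EuclideanSpace ℂ (Fin L) →ₗᵢ[ℂ] Power n₂ D₂) (φ : Bipartite K L)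
    (x : Config (Sum.elim (fun _ : Fin n₁ => D₁) (fun _ : Fin n₂ => D₂))) :
    tensorMap V₁ V₂ φ x = ∑ p : Fin K × Fin L, φ p *
      (V₁ (EuclideanSpace.single p.1 1) (leftPart x) *
        V₂ (EuclideanSpace.single p.2 1) (rightPart x)) := by
  simp [tensorMap, tensorVec]

theorem sum_tensorMap_mul_conj {K L n₁ D₁ n₂ D₂ : ℕ}
    (V₁ : EuclideanSpace ℂ (Fin K) →ₗᵢ[ℂ] Power n₁ D₁)
    (V₂ : EuclideanSpace ℂ (Fin L) →ₗᵢ[ℂ] Power n₂ D₂) (φ : Bipartite K L) {W : Type} [Fintype W]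
    (s t : W → Config (Sum.elim (fun _ : Fin n₁ => D₁) (fun _ : Fin n₂ => D₂))) :
    ∑ w, tensorMap V₁ V₂ φ (s w) * conj (tensorMap V₁ V₂ φ (t w)) =
      ∑ p : Fin K × Fin L, ∑ q : Fin K × Fin L, φ p * conj (φ q) * ∑ w,
        V₁ (EuclideanSpace.single p.1 1) (leftPart (s w)) *
            conj (V₁ (EuclideanSpace.single q.1 1) (leftPart (t w))) *
          (V₂ (EuclideanSpace.single p.2 1) (rightPart (s w)) *
            conj (V₂ (EuclideanSpace.single q.2 1) (rightPart (t w)))) := by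
  simp only [tensorMap_apply, map_sum, Finset.sum_mul_sum]
  rw [Finset.sum_comm]
  refine Finset.sum_congr rfl fun p _ => ?_
  rw [Finset.sum_comm]
  refine Finset.sum_congr rfl fun q _ => ?_
  rw [Finset.mul_sum]
  refine Finset.sum_congr rfl fun w _ => ?_
  simp only [map_mul]
  ring

/-- The reduction of `(V₁ ⊗ V₂) φ` splits into reductions on the two sides. -/
theorem trOut_tensorMap {K L n₁ D₁ n₂ D₂ : ℕ}
    (V₁ : EuclideanSpace ℂ (Fin K) →ₗᵢ[ℂ] Power n₁ D₁)
    (V₂ : EuclideanSpace ℂ (Fin L) →ₗᵢ[ℂ] Power n₂ D₂) (φ : Bipartite K L)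
    (S : Finset (Fin n₁ ⊕ Fin n₂))
    (x y : Config (Sum.elim (fun _ : Fin n₁ => D₁) (fun _ : Fin n₂ => D₂))) :
    trOut S (ketBra (tensorMap V₁ V₂ φ)) x y =
      ∑ p : Fin K × Fin L, ∑ q : Fin K × Fin L, φ p * conj (φ q) *
        (trOut S.toLeft (ketBraPair (V₁ (EuclideanSpace.single p.1 1))
            (V₁ (EuclideanSpace.single q.1 1))) (leftPart x) (leftPart y) *
          trOut S.toRight (ketBraPair (V₂ (EuclideanSpace.single p.2 1))
            (V₂ (EuclideanSpace.single q.2 1))) (rightPart x) (rightPart y)) := by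
  simp only [trOut, ← sum_config_elim, ketBra]
  rw [sum_tensorMap_mul_conj]
  simp only [leftPart_piecewise, rightPart_piecewise, ketBraPair]

/-- Contraction of a maximally entangled state with the identity on the first party. -/
theorem IsMaximallyEntangled.sum_left {K : ℕ} {φ : Bipartite K K} (hφ : IsMaximallyEntangled φ)
    (g : ℂ) (G : Fin K → Fin K → ℂ) :
    ∑ p : Fin K × Fin K, ∑ q : Fin K × Fin K,
      φ p * conj (φ q) * ((if p.1 = q.1 then g else 0) * G p.2 q.2) =
      g * ((K : ℂ)⁻¹ * ∑ j, G j j) := by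
  have h : ∀ j j', ∑ i, φ (i, j) * conj (φ (i, j')) = if j = j' then (K : ℂ)⁻¹ else 0 := by
    intro j j'
    have := congrFun (congrFun hφ.2.2 j) j'
    simpa [traceLeft, ketBra, Matrix.one_apply] using this
  have h1 : ∀ j j', ∑ i, φ (i, j) * conj (φ (i, j')) * (g * G j j') =
      if j = j' then (K : ℂ)⁻¹ * (g * G j j') else 0 := by
    intro j j'
    rw [← Finset.sum_mul, h, ite_mul, zero_mul]
  have h2 : ∀ i j, ∑ q : Fin K × Fin K,
      φ (i, j) * conj (φ q) * ((if i = q.1 then g else 0) * G j q.2) =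
      ∑ j', φ (i, j) * conj (φ (i, j')) * (g * G j j') := by
    intro i j
    rw [Fintype.sum_prod_type, Finset.sum_comm]
    refine Finset.sum_congr rfl fun j' _ => ?_
    simp
  rw [Fintype.sum_prod_type, Finset.sum_comm]
  simp only [h2]
  rw [Finset.mul_sum, Finset.mul_sum]
  refine Finset.sum_congr rfl fun j _ => ?_
  rw [Finset.sum_comm]
  simp only [h1]
  simp
  ring

/-- Exchange of the two parties. -/
theorem IsMaximallyEntangled.swap {K : ℕ} {φ : Bipartite K K} (hφ : IsMaximallyEntangled φ) :
    IsMaximallyEntangled (WithLp.toLp 2 fun p => φ p.swap : Bipartite K K) := by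
  refine ⟨?_, hφ.2.2, hφ.2.1⟩
  rw [← hφ.1, EuclideanSpace.norm_eq, EuclideanSpace.norm_eq]
  congr 1
  exact Equiv.sum_comp (Equiv.prodComm _ _) fun p => ‖φ p‖ ^ 2

/-- Contraction of a maximally entangled state with the identity on the second party. -/
theorem IsMaximallyEntangled.sum_right {K : ℕ} {φ : Bipartite K K} (hφ : IsMaximallyEntangled φ)
    (g : ℂ) (G : Fin K → Fin K → ℂ) :
    ∑ p : Fin K × Fin K, ∑ q : Fin K × Fin K,
      φ p * conj (φ q) * (G p.1 q.1 * (if p.2 = q.2 then g else 0)) =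
      g * ((K : ℂ)⁻¹ * ∑ j, G j j) := by
  rw [← hφ.swap.sum_left, ← Equiv.sum_comp (Equiv.prodComm _ _)]
  refine Finset.sum_congr rfl fun p _ => ?_
  rw [← Equiv.sum_comp (Equiv.prodComm _ _)]
  refine Finset.sum_congr rfl fun q _ => ?_
  exact congrArg (_ * ·) (mul_comm _ _)

theorem orthonormal_encoding {n K D : ℕ} (V : EuclideanSpace ℂ (Fin K) →ₗᵢ[ℂ] Power n D) :
    Orthonormal ℂ fun k => V (EuclideanSpace.single k 1) :=
  (EuclideanSpace.orthonormal_single (𝕜 := ℂ) (ι := Fin K)).comp_linearIsometry V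

theorem IsEncoding.mem {n K D : ℕ} {C : Submodule ℂ (Power n D)}
    {V : EuclideanSpace ℂ (Fin K) →ₗᵢ[ℂ] Power n D} (hV : IsEncoding C V)
    (v : EuclideanSpace ℂ (Fin K)) : V v ∈ C := by
  rw [← hV]
  exact ⟨v, rfl⟩

theorem sum_elim_agree {n₁ D₁ n₂ D₂ : ℕ} (S : Finset (Fin n₁ ⊕ Fin n₂))
    (x y : Config (Sum.elim (fun _ : Fin n₁ => D₁) (fun _ : Fin n₂ => D₂))) :
    (∀ i ∈ S, x i = y i) ↔ (∀ i ∈ S.toLeft, leftPart x i = leftPart y i) ∧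
      ∀ i ∈ S.toRight, rightPart x i = rightPart y i := by
  simp [leftPart, rightPart, Sum.forall]

theorem norm_tensorMap {K n₁ D₁ n₂ D₂ : ℕ} (hK : K ≠ 0)
    (V₁ : EuclideanSpace ℂ (Fin K) →ₗᵢ[ℂ] Power n₁ D₁)
    (V₂ : EuclideanSpace ℂ (Fin K) →ₗᵢ[ℂ] Power n₂ D₂) {φ : Bipartite K K}
    (hφ : IsMaximallyEntangled φ) : ‖tensorMap V₁ V₂ φ‖ = 1 := by
  have hin : ∀ {n D : ℕ} (V : EuclideanSpace ℂ (Fin K) →ₗᵢ[ℂ] Power n D) (k k' : Fin K),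
      ∑ w, V (EuclideanSpace.single k 1) w * conj (V (EuclideanSpace.single k' 1) w) =
        if k = k' then 1 else 0 := by
    intro n D V k k'
    have := orthonormal_iff_ite.mp (orthonormal_encoding V) k' k
    rw [PiLp.inner_apply] at this
    simpa [eq_comm] using this
  have key : ∑ w, tensorMap V₁ V₂ φ w * conj (tensorMap V₁ V₂ φ w) = 1 := by
    have h := hφ.sum_left 1 fun j j' => if j = j' then 1 else 0
    simp only [if_true, Finset.sum_const, Finset.card_univ, Fintype.card_fin, nsmul_eq_mul,
      mul_one, inv_mul_cancel₀ (Nat.cast_ne_zero.mpr hK : (K : ℂ) ≠ 0)] at h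
    rw [← h, sum_tensorMap_mul_conj V₁ V₂ φ (fun w => w) fun w => w]
    refine Finset.sum_congr rfl fun p _ => Finset.sum_congr rfl fun q _ => ?_
    rw [← hin V₁, ← hin V₂, ← sum_config_elim]
  have h1 : (inner ℂ (tensorMap V₁ V₂ φ) (tensorMap V₁ V₂ φ) : ℂ) = 1 := by
    rw [PiLp.inner_apply, ← key]
    rfl
  have h2 : ‖tensorMap V₁ V₂ φ‖ ^ 2 = 1 := by
    rw [← inner_self_eq_norm_sq (𝕜 := ℂ), h1]
    rfl
  rwa [pow_eq_one_iff_of_nonneg (norm_nonneg _) two_ne_zero] at h2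

theorem IsQMDS.isUniform_tensorMap {n₁ n₂ K d₁ d₂ D₁ D₂ : ℕ} (hK : 1 < K)
    {C₁ : Submodule ℂ (Power n₁ D₁)} {C₂ : Submodule ℂ (Power n₂ D₂)}
    (h₁ : IsQMDS n₁ K d₁ D₁ C₁) (h₂ : IsQMDS n₂ K d₂ D₂ C₂)
    {V₁ : EuclideanSpace ℂ (Fin K) →ₗᵢ[ℂ] Power n₁ D₁}
    {V₂ : EuclideanSpace ℂ (Fin K) →ₗᵢ[ℂ] Power n₂ D₂} {φ : Bipartite K K}
    (hV₁ : IsEncoding C₁ V₁) (hV₂ : IsEncoding C₂ V₂) (hφ : IsMaximallyEntangled φ) {l : ℕ}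
    (hl₁ : l ≤ n₁ - (d₁ - 1)) (hl₂ : l ≤ n₂ - (d₂ - 1)) (hl : l ≤ (d₁ - 1) + (d₂ - 1) + 1) :
    IsUniform l (tensorMap V₁ V₂ φ) := by
  refine isUniform_of_isScalarOn (norm_tensorMap (by omega) V₁ V₂ hφ) ?_ fun S hS => ?_
  · simp only [Fintype.card_sum, Fintype.card_fin]
    omega
  have hcard := S.card_toLeft_add_card_toRight
  have hd₁ := h₁.one_le_dist
  have hd₂ := h₂.one_le_dist
  have ho₁ := orthonormal_encoding V₁
  have ho₂ := orthonormal_encoding V₂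
  obtain ⟨c₁, hc₁⟩ := h₁.isScalarOn hK ho₁ (fun k => hV₁.mem _)
    (T := S.toLeft) (by omega)
  obtain ⟨c₂, hc₂⟩ := h₂.isScalarOn hK ho₂ (fun k => hV₂.mem _)
    (T := S.toRight) (by omega)
  have hK0 : (K : ℂ) ≠ 0 := Nat.cast_ne_zero.mpr (by omega)
  -- `c₁` and `c₂` normalize the code projectors, of trace `K`, hence the factors `K⁻¹`.
  refine ⟨(K : ℂ)⁻¹ * c₁ * ((K : ℂ)⁻¹ * c₂), fun x y => ?_⟩
  have hc₁' := hc₁ (leftPart x) (leftPart y)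
  have hc₂' := hc₂ (rightPart x) (rightPart y)
  rw [trOut_tensorMap, if_congr (sum_elim_agree S x y) rfl rfl, ite_and]
  rw [trOut_sum] at hc₁' hc₂'
  -- One of the two sides contains few enough parties of `S` to be uncorrelated with the other.
  rcases (by omega : S.toLeft.card < d₁ ∨ S.toRight.card < d₂) with hlt | hlt
  · obtain ⟨g, hg⟩ := h₁.exists_trOut_orthonormal hlt ho₁ fun k => hV₁.mem _
    have hg' : ∀ k k', trOut S.toLeft (ketBraPair (V₁ (EuclideanSpace.single k 1))
        (V₁ (EuclideanSpace.single k' 1))) (leftPart x) (leftPart y) =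
        if k = k' then g (leftPart x) (leftPart y) else 0 := by
      intro k k'
      rw [hg]
      split_ifs <;> rfl
    simp only [hg', if_true, Finset.sum_const, Finset.card_univ, Fintype.card_fin,
      nsmul_eq_mul] at hc₁'
    simp only [hg']
    rw [hφ.sum_left (g (leftPart x) (leftPart y)) fun j j' =>
      trOut S.toRight (ketBraPair (V₂ (EuclideanSpace.single j 1))
        (V₂ (EuclideanSpace.single j' 1))) (rightPart x) (rightPart y), hc₂']
    rw [← eq_inv_mul_iff_mul_eq₀ hK0] at hc₁'
    rw [hc₁']
    split_ifs <;> simp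
  · obtain ⟨g, hg⟩ := h₂.exists_trOut_orthonormal hlt ho₂ fun k => hV₂.mem _
    have hg' : ∀ k k', trOut S.toRight (ketBraPair (V₂ (EuclideanSpace.single k 1))
        (V₂ (EuclideanSpace.single k' 1))) (rightPart x) (rightPart y) =
        if k = k' then g (rightPart x) (rightPart y) else 0 := by
      intro k k'
      rw [hg]
      split_ifs <;> rfl
    simp only [hg', if_true, Finset.sum_const, Finset.card_univ, Fintype.card_fin,
      nsmul_eq_mul] at hc₂'
    simp only [hg']
    rw [hφ.sum_right (g (rightPart x) (rightPart y)) fun j j' =>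
      trOut S.toLeft (ketBraPair (V₁ (EuclideanSpace.single j 1))
        (V₁ (EuclideanSpace.single j' 1))) (leftPart x) (leftPart y), hc₁']
    rw [← eq_inv_mul_iff_mul_eq₀ hK0] at hc₂'
    rw [hc₂']
    split_ifs <;> simp [mul_comm]

theorem IsCode.exists_isEncoding {n K d D : ℕ} {C : Submodule ℂ (Power n D)}
    (h : IsCode n K d D C) :
    ∃ V : EuclideanSpace ℂ (Fin K) →ₗᵢ[ℂ] Power n D, IsEncoding C V := by
  let e := ((stdOrthonormalBasis ℂ C).reindex (finCongr h.finrank_eq)).repr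
  refine ⟨C.subtypeₗᵢ.comp e.symm.toLinearIsometry, ?_⟩
  ext v
  constructor
  · rintro ⟨u, rfl⟩
    exact (e.symm u).2
  · intro hv
    exact ⟨e ⟨v, hv⟩, by simp⟩

theorem exists_isMaximallyEntangled {K : ℕ} (hK : K ≠ 0) :
    ∃ φ : Bipartite K K, IsMaximallyEntangled φ := by
  have hK0 : (K : ℂ) ≠ 0 := Nat.cast_ne_zero.mpr hK
  have hpos : (0 : ℝ) < K := by exact_mod_cast Nat.pos_of_ne_zero hK
  have hs : ((√(K : ℝ) : ℝ) : ℂ)⁻¹ * ((√(K : ℝ) : ℝ) : ℂ)⁻¹ = (K : ℂ)⁻¹ := by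
    rw [← mul_inv, ← Complex.ofReal_mul, Real.mul_self_sqrt hpos.le]
    simp
  refine ⟨WithLp.toLp 2 fun p => if p.1 = p.2 then ((√(K : ℝ) : ℝ) : ℂ)⁻¹ else 0, ?_, ?_, ?_⟩
  · rw [EuclideanSpace.norm_eq, Real.sqrt_eq_one, Fintype.sum_prod_type]
    simp [apply_ite norm, ite_pow, hpos.ne']
  · ext i j
    simp [traceRight, ketBra, Matrix.one_apply, apply_ite conj, hs]
  · ext i j
    simp [traceLeft, ketBra, Matrix.one_apply, apply_ite conj, hs, eq_comm]

end Concatenation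

end QUniform

theorem theorem2 (n₁ n₂ K d₁ d₂ D₁ D₂ : ℕ) (hK : 1 < K)
    (C₁ : Submodule ℂ (QUniform.Power n₁ D₁)) (C₂ : Submodule ℂ (QUniform.Power n₂ D₂))
    (h₁ : QUniform.IsQMDS n₁ K d₁ D₁ C₁) (h₂ : QUniform.IsQMDS n₂ K d₂ D₂ C₂)
    (r₁ r₂ l : ℕ) (hr₁ : r₁ = d₁ - 1) (hr₂ : r₂ = d₂ - 1)
    (hl : l = min (min (n₁ - r₁) (n₂ - r₂)) (r₁ + r₂ + 1)) :
    (∀ (V₁ : EuclideanSpace ℂ (Fin K) →ₗᵢ[ℂ] QUniform.Power n₁ D₁)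
        (V₂ : EuclideanSpace ℂ (Fin K) →ₗᵢ[ℂ] QUniform.Power n₂ D₂)
        (φ : QUniform.Bipartite K K),
        QUniform.IsEncoding C₁ V₁ → QUniform.IsEncoding C₂ V₂ →
        QUniform.IsMaximallyEntangled φ →
        QUniform.IsUniform l (QUniform.tensorMap V₁ V₂ φ)) ∧
      ∃ ψ : QUniform.Power₂ n₁ D₁ n₂ D₂, QUniform.IsUniform l ψ := by
  subst hr₁ hr₂ hl
  have main : ∀ (V₁ : EuclideanSpace ℂ (Fin K) →ₗᵢ[ℂ] QUniform.Power n₁ D₁)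
      (V₂ : EuclideanSpace ℂ (Fin K) →ₗᵢ[ℂ] QUniform.Power n₂ D₂)
      (φ : QUniform.Bipartite K K),
      QUniform.IsEncoding C₁ V₁ → QUniform.IsEncoding C₂ V₂ →
      QUniform.IsMaximallyEntangled φ →
      QUniform.IsUniform (min (min (n₁ - (d₁ - 1)) (n₂ - (d₂ - 1))) ((d₁ - 1) + (d₂ - 1) + 1))
        (QUniform.tensorMap V₁ V₂ φ) := fun V₁ V₂ φ hV₁ hV₂ hφ =>
    h₁.isUniform_tensorMap hK h₂ hV₁ hV₂ hφ ((min_le_left _ _).trans (min_le_left _ _))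
      ((min_le_left _ _).trans (min_le_right _ _)) (min_le_right _ _)
  obtain ⟨V₁, hV₁⟩ := h₁.toIsCode.exists_isEncoding
  obtain ⟨V₂, hV₂⟩ := h₂.toIsCode.exists_isEncoding
  obtain ⟨φ, hφ⟩ := QUniform.exists_isMaximallyEntangled (K := K) (by omega)
  exact ⟨main, _, main V₁ V₂ φ hV₁ hV₂ hφ⟩
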